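/- Let $q$ be an indeterminate, and put $[k]=\frac{1-q^k}{1-q}$ and $[k]!=\prod_{i=1}^k\frac{1-q^i}{1-q}$. For integers $m,n\ge 0$ let $$S_{2m+1,n}(q)=\sum_{k=1}^{n}\frac{[2k]}{[2]}\,[k]^{2m}\,q^{(m+1)(n-k)}.$$ For every $m\ge 0$ there is exactly one family of polynomials $P_{m,0},\dots,P_{m,m}\in\mathbb{Z}[q]$ such that, for all $n\ge 0$, $$S_{2m+1,n}(q)=\sum_{k=0}^m(-1)^{m-k}\,\frac{[k]!}{[m+1]!}\,P_{m,m-k}(q)\,q^{(m-k)n}\,\frac{([n][n+1])^{k+1}}{[2]}$$ in $\mathbb{Q}(q)$. For all $0\le k\le m$, the coefficients of $P_{m,k}$ are nonnegative, and they are symmetric (palindromic): if $P_{m,k}=a_0+a_1q+\dots+a_dq^d$ with $d=\deg P_{m,k}$, then $a_i=a_{d-i}$ for $0\le i\le d$. (The condition is void when $P_{m,k}=0$.) -/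

import Mathlib

open Polynomial

namespace QFaulhaber

/-- The variable `q`, as an element of the field `ℚ(q)` of rational functions. -/
noncomputable def q : RatFunc ℚ := RatFunc.X

/-- The `q`-number `[k] = (1 - q^k) / (1 - q)`. -/
noncomputable def qNum (k : ℕ) : RatFunc ℚ := (1 - q ^ k) / (1 - q)

/-- The `q`-factorial `[k]! = ∏_{i=1}^k (1 - q^i) / (1 - q)`. -/
noncomputable def qFact (k : ℕ) : RatFunc ℚ :=
  ∏ i ∈ Finset.Icc 1 k, (1 - q ^ i) / (1 - q)

/-- The `q`-analogue of the sum of odd powers,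
`S_{2m+1,n}(q) = ∑_{k=1}^n [2k]/[2] * [k]^(2m) * q^((m+1)(n-k))`.
In the general `S_{r,n}(q)` the exponents are `r - 1` and `(r+1)/2 * (n-k)`; for `r = 2m+1` they
are the natural numbers `2m` and `(m+1)(n-k)`. -/
noncomputable def oddPowerSum (m n : ℕ) : RatFunc ℚ :=
  ∑ k ∈ Finset.Icc 1 n,
    qNum (2 * k) / qNum 2 * qNum k ^ (2 * m) * q ^ ((m + 1) * (n - k))

/-- An integer polynomial in `q`, viewed in `ℚ(q)`. -/
noncomputable def toRatFunc (p : ℤ[X]) : RatFunc ℚ := aeval q p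

/-- `P 0, …, P m` are the `q`-Faulhaber polynomials `P_{m,0}, …, P_{m,m}`: for every `n`,
`S_{2m+1,n}(q) = ∑_{k=0}^m (-1)^(m-k) [k]!/[m+1]! P_{m,m-k} q^((m-k)n) ([n][n+1])^(k+1) / [2]`.
Here `k.rev` is the index `m - k`. -/
def IsFaulhaberFamily (m : ℕ) (P : Fin (m + 1) → ℤ[X]) : Prop :=
  ∀ n : ℕ, oddPowerSum m n =
    ∑ k : Fin (m + 1),
      (-1) ^ (m - (k : ℕ)) * (qFact k / qFact (m + 1)) * toRatFunc (P k.rev) *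
        q ^ ((m - (k : ℕ)) * n) * ((qNum n * qNum (n + 1)) ^ ((k : ℕ) + 1) / qNum 2)

end QFaulhaber

/-! Put y_n = [n][n+1]/q^n and x = [n+1]^2/q^(n+1). The sum and product of u = y_(n+1) and v = y_n
are (1+q)x and qx^2 - x, so u^(j+1) - v^(j+1) = (u - v) h_j(x) for one polynomial h_j,
`powDiffPoly`, of degree j. If x^m = ∑ c_l h_l, then ∑ c_l y_n^(l+1) telescopes to the odd power
sum, up to the factor [2] and a power of q (`oddPowerSum_eq`). The Faulhaber coefficients are
therefore entries of the inverse of the triangular coefficient matrix of the h_j. Its diagonal is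
[j+1], so Cramer's rule produces the sign, the ratio of q-factorials, and P_(m,m-k) as a minor,
which lies in ℤ[q] (`mul_prod_coeff_eq_minorDet`, `isFaulhaberFamily_minorDet`).

Nonnegativity: `coeff_powDiffPoly_eq_coeff` writes the entries as coefficients of
t^j/((1-t)(1-qt))^(j+1-i). Such a matrix arises from the identity by adding 1 or q times a column to
the next one, which keeps all minors in ℕ[q].

Symmetry: q ↦ 1/q multiplies the (j,i) entry by q^(j-2i), hence each minor by a power of q. This
gives a palindrome once the constant term is nonzero; at q = 0 the minors are ballot numbers,
positive outside a case where the minor vanishes.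

Uniqueness holds because the y_n are distinct. -/

namespace QFaulhaber

/-! ### Total nonnegativity by column operations. -/

section TotalNonnegativity

variable {R : Type*} [CommRing R]

/-- All minors of `M` lie in the subsemiring `S`, thought of as a set of nonnegative elements. -/
def IsTotallyNonneg (S : Subsemiring R) (M : Matrix ℕ ℕ R) : Prop :=
  ∀ (n : ℕ) (r c : Fin n → ℕ), StrictMono r → StrictMono c → (M.submatrix r c).det ∈ S

theorem isTotallyNonneg_one (S : Subsemiring R) : IsTotallyNonneg S (1 : Matrix ℕ ℕ R) := by
  intro n r c hr hc
  by_cases h : ∀ p, r p ∈ Set.range c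
  · have hsub : Set.range r ⊆ Set.range c := by
      rintro _ ⟨p, rfl⟩
      exact h p
    have heq : Set.range r = Set.range c := by
      refine Set.eq_of_subset_of_ncard_le hsub ?_
      rw [← Set.image_univ, ← Set.image_univ, Set.ncard_image_of_injective _ hr.injective,
        Set.ncard_image_of_injective _ hc.injective]
    have hrc : r = c := (StrictMono.range_inj hr hc).1 heq
    subst hrc
    rw [Matrix.submatrix_one _ hr.injective, Matrix.det_one]
    exact S.one_mem
  · push Not at h
    obtain ⟨p, hp⟩ := h
    rw [Matrix.det_eq_zero_of_row_eq_zero p]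
    · exact S.zero_mem
    · intro a
      rw [Matrix.submatrix_apply, Matrix.one_apply_ne]
      exact fun h' => hp ⟨a, h'.symm⟩

/-- Add `w` times column `x` to column `x + 1`. -/
def addCol (w : R) (x : ℕ) (M : Matrix ℕ ℕ R) : Matrix ℕ ℕ R :=
  fun j z => M j z + if z = x + 1 then w * M j x else 0

theorem addCol_apply_of_ne (w : R) {x z : ℕ} (M : Matrix ℕ ℕ R) (j : ℕ) (h : z ≠ x + 1) :
    addCol w x M j z = M j z := by
  simp [addCol, h]

theorem addCol_apply_succ (w : R) (x : ℕ) (M : Matrix ℕ ℕ R) (j : ℕ) :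
    addCol w x M j (x + 1) = M j (x + 1) + w * M j x := by
  simp [addCol]

/-- By linearity in the changed column, a new minor is an old one plus `w` times the determinant
with column `x + 1` replaced by `x`. The latter has a repeated column or is again a minor with
increasing columns. -/
theorem IsTotallyNonneg.addCol {S : Subsemiring R} {M : Matrix ℕ ℕ R}
    (hM : IsTotallyNonneg S M) {w : R} (hw : w ∈ S) (x : ℕ) :
    IsTotallyNonneg S (addCol w x M) := by
  intro n r c hr hc
  by_cases h : ∃ p, c p = x + 1
  · obtain ⟨p, hp⟩ := h
    have h1 : (QFaulhaber.addCol w x M).submatrix r c =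
        (M.submatrix r c).updateCol p
          ((fun a => M (r a) (x + 1)) + w • fun a => M (r a) x) := by
      ext a b
      rw [Matrix.updateCol_apply]
      split_ifs with hb
      · subst hb
        simp [hp, addCol_apply_succ]
      · rw [Matrix.submatrix_apply, addCol_apply_of_ne]
        · rfl
        · exact fun h' => hb (hc.injective (h'.trans hp.symm))
    have h2 : (M.submatrix r c).updateCol p (fun a => M (r a) (x + 1)) = M.submatrix r c := by
      ext a b
      rw [Matrix.updateCol_apply]
      split_ifs with hb
      · subst hb
        simp [hp]
      · rfl
    have h3 : (M.submatrix r c).updateCol p (fun a => M (r a) x) =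
        M.submatrix r (Function.update c p x) := by
      ext a b
      rw [Matrix.updateCol_apply]
      split_ifs with hb
      · subst hb
        simp
      · simp [Function.update_of_ne hb]
    rw [h1, Matrix.det_updateCol_add, Matrix.det_updateCol_smul, h2, h3]
    refine S.add_mem (hM n r c hr hc) (S.mul_mem hw ?_)
    by_cases h' : ∃ p', c p' = x
    · obtain ⟨p', hp'⟩ := h'
      have hne : p ≠ p' := by
        rintro rfl
        omega
      rw [Matrix.det_zero_of_column_eq hne]
      · exact S.zero_mem
      · intro a
        simp [Function.update_of_ne hne.symm, hp']
    · push Not at h'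
      refine hM n r _ hr ?_
      intro a b hab
      have hlt := hc hab
      have ha := h' a
      have hb := h' b
      by_cases hap : a = p
      · subst hap
        rw [Function.update_self, Function.update_of_ne hab.ne']
        omega
      · rw [Function.update_of_ne hap]
        by_cases hbp : b = p
        · subst hbp
          rw [Function.update_self]
          omega
        · rwa [Function.update_of_ne hbp]
  · push Not at h
    have h1 : (QFaulhaber.addCol w x M).submatrix r c = M.submatrix r c := by
      ext a b
      exact addCol_apply_of_ne w M _ (h b)
    rw [h1]
    exact hM n r c hr hc

/-- Apply `addCol w x` successively for `x = a, …, a + n - 1`. -/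
def sweep (w : R) (a : ℕ) : ℕ → Matrix ℕ ℕ R → Matrix ℕ ℕ R
  | 0, M => M
  | n + 1, M => addCol w (a + n) (sweep w a n M)

theorem IsTotallyNonneg.sweep {S : Subsemiring R} {M : Matrix ℕ ℕ R}
    (hM : IsTotallyNonneg S M) {w : R} (hw : w ∈ S) (a n : ℕ) :
    IsTotallyNonneg S (sweep w a n M) := by
  induction n with
  | zero => exact hM
  | succ n ih => exact ih.addCol hw _

theorem sweep_apply_of_lt (w : R) (a n : ℕ) (M : Matrix ℕ ℕ R) (j : ℕ) {z : ℕ} (h : a + n < z) :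
    sweep w a n M j z = M j z := by
  induction n with
  | zero => rfl
  | succ n ih =>
    rw [sweep, addCol_apply_of_ne _ _ _ (by omega), ih (by omega)]

theorem sweep_apply_of_eq_zero (w : R) (a n : ℕ) (M : Matrix ℕ ℕ R) (j : ℕ)
    (h : ∀ z, a ≤ z → z ≤ a + n → M j z = 0) (z : ℕ) :
    sweep w a n M j z = M j z := by
  induction n generalizing z with
  | zero => rfl
  | succ n ih =>
    have ih' := ih (fun z h1 h2 => h z h1 (by omega))
    by_cases hz : z = a + n + 1
    · subst hz
      rw [sweep, addCol_apply_succ, ih', ih', h (a + n) (by omega) (by omega), mul_zero, add_zero]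
    · rw [sweep, addCol_apply_of_ne _ _ _ hz, ih']

/-- The geometric series with ratio `w`. -/
noncomputable def geomSeries (w : R) : PowerSeries R := PowerSeries.mk fun n => w ^ n

theorem geomSeries_eq (w : R) :
    geomSeries w = 1 + PowerSeries.C w * (PowerSeries.X * geomSeries w) := by
  ext n
  cases n with
  | zero => simp [geomSeries]
  | succ n =>
    simp [geomSeries, PowerSeries.coeff_succ_X_mul, pow_succ', PowerSeries.coeff_one]

theorem coeff_succ_mul_geomSeries (w : R) (F : PowerSeries R) (n : ℕ) :
    PowerSeries.coeff (n + 1) (F * geomSeries w) =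
      PowerSeries.coeff (n + 1) F + w * PowerSeries.coeff n (F * geomSeries w) := by
  conv_lhs => rw [geomSeries_eq]
  rw [show F * (1 + PowerSeries.C w * (PowerSeries.X * geomSeries w)) =
    F + PowerSeries.C w * (PowerSeries.X * (F * geomSeries w)) by ring, map_add,
    PowerSeries.coeff_C_mul, PowerSeries.coeff_succ_X_mul]

/-- Each added column has itself just been updated, which is the recurrence for dividing a series by
1 - wt. The sweep may start at column `a` because nothing lies to its left. -/
theorem sweep_apply_eq_coeff (w : R) (a n : ℕ) (M : Matrix ℕ ℕ R) (j : ℕ) (F : PowerSeries R)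
    (hF : PowerSeries.X ^ a ∣ F) (h : ∀ z ≤ a + n, M j z = PowerSeries.coeff z F) :
    ∀ z ≤ a + n, sweep w a n M j z = PowerSeries.coeff z (F * geomSeries w) := by
  induction n with
  | zero =>
    intro z hz
    rw [sweep, h z hz]
    obtain ⟨F, rfl⟩ := hF
    rw [mul_assoc, PowerSeries.coeff_X_pow_mul', PowerSeries.coeff_X_pow_mul']
    split_ifs with haz
    · have : z - a = 0 := by omega
      rw [this]
      simp [geomSeries]
    · rfl
  | succ n ih =>
    have ih' := ih (fun z hz => h z (by omega))
    intro z hz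
    by_cases hz' : z = a + n + 1
    · subst hz'
      rw [sweep, addCol_apply_succ, ih' _ le_rfl, coeff_succ_mul_geomSeries,
        sweep_apply_of_lt _ _ _ _ _ (by omega), h _ hz]
    · rw [sweep, addCol_apply_of_ne _ _ _ hz', ih' _ (by omega)]

/-- The power series `1 / ((1 - t) (1 - a t))`. -/
noncomputable def twoGeomSeries (a : R) : PowerSeries R := geomSeries 1 * geomSeries a

theorem twoGeomSeries_eq (a : R) :
    twoGeomSeries a = 1 + PowerSeries.C (1 + a) * (PowerSeries.X * twoGeomSeries a) -
      PowerSeries.C a * (PowerSeries.X * (PowerSeries.X * twoGeomSeries a)) := by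
  have h1 := geomSeries_eq (1 : R)
  have ha := geomSeries_eq a
  rw [map_one] at h1
  rw [twoGeomSeries, map_add, map_one]
  linear_combination (geomSeries a - PowerSeries.C a * PowerSeries.X * geomSeries a) * h1 + ha

/-- Descending induction on `K`. Passing from `K + 1` to `K` sweeps columns `K + 1` to `2 * K` with
weights 1 and `a`, multiplying the rows `j ≥ K` by one more factor. Column `2 * (K + 1)` is not
touched again, so it keeps the exponent `j + 1 - (K + 1)`. -/
theorem exists_isTotallyNonneg_coeff (S : Subsemiring R) {a : R} (ha : a ∈ S) (N t K : ℕ)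
    (hK : K + t = N) :
    ∃ M : Matrix ℕ ℕ R, IsTotallyNonneg S M ∧
      (∀ j < N, ∀ z ≤ 2 * K,
        M j z = PowerSeries.coeff z (PowerSeries.X ^ j * twoGeomSeries a ^ (j + 1 - K))) ∧
      (∀ j < N, ∀ i > K,
        M j (2 * i) =
          PowerSeries.coeff (2 * i) (PowerSeries.X ^ j * twoGeomSeries a ^ (j + 1 - i))) := by
  induction t generalizing K with
  | zero =>
    refine ⟨1, isTotallyNonneg_one S, ?_, ?_⟩
    · intro j hj z _
      -- At `K = N` the truncated exponent is 0 for every row, leaving the identity matrix.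
      rw [show j + 1 - K = 0 by omega, pow_zero, mul_one, PowerSeries.coeff_X_pow,
        Matrix.one_apply]
      simp only [eq_comm]
    · intro j hj i hi
      rw [show j + 1 - i = 0 by omega, pow_zero, mul_one, PowerSeries.coeff_X_pow,
        Matrix.one_apply]
      simp only [eq_comm]
  | succ t ih =>
    obtain ⟨M, hM, h1, h2⟩ := ih (K + 1) (by omega)
    refine ⟨sweep a K K (sweep 1 K K M), (hM.sweep S.one_mem K K).sweep ha K K, ?_, ?_⟩
    · intro j hj z hz
      by_cases hjK : j < K
      -- Here the truncated exponent stays 0: the row is t^j with `j < K`, and the sweeps see only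
      -- zeros.
      · have hzero : ∀ z, K ≤ z → z ≤ K + K → M j z = 0 := by
          intro z hz1 hz2
          rw [h1 j hj z (by omega), show j + 1 - (K + 1) = 0 by omega, pow_zero, mul_one,
            PowerSeries.coeff_X_pow, if_neg (by omega)]
        have hs := sweep_apply_of_eq_zero (1 : R) K K M j hzero
        rw [sweep_apply_of_eq_zero, hs, h1 j hj z (by omega),
          show j + 1 - (K + 1) = 0 by omega, show j + 1 - K = 0 by omega]
        intro z hz1 hz2
        rw [hs, hzero z hz1 hz2]
      · have hdvd : (PowerSeries.X : PowerSeries R) ^ K ∣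
            PowerSeries.X ^ j * twoGeomSeries a ^ (j + 1 - (K + 1)) :=
          (pow_dvd_pow _ (by omega)).mul_right _
        rw [sweep_apply_eq_coeff a K K _ j _ (hdvd.mul_right _)
          (sweep_apply_eq_coeff 1 K K M j _ hdvd fun z hz => h1 j hj z (by omega)) z (by omega),
          show j + 1 - K = (j + 1 - (K + 1)) + 1 by omega, pow_succ, mul_assoc, mul_assoc,
          twoGeomSeries]
    · intro j hj i hi
      rw [sweep_apply_of_lt _ _ _ _ _ (by omega), sweep_apply_of_lt _ _ _ _ _ (by omega)]
      rcases Nat.lt_or_ge (K + 1) i with h | h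
      · exact h2 j hj i h
      · obtain rfl : i = K + 1 := by omega
        exact h1 j hj _ le_rfl

end TotalNonnegativity

/-! ### The polynomials h_j and their coefficient matrix. -/

section PowDiffPoly

variable {R : Type*} [CommRing R]

/-- The polynomial `h_j` in `x` such that `(u - v) * h_j(x) = u ^ (j + 1) - v ^ (j + 1)` whenever
`u + v = (1 + a) x` and `u v = a x ^ 2 - x`. -/
noncomputable def powDiffPoly (a : R) : ℕ → R[X]
  | 0 => 1
  | 1 => C (1 + a) * X
  | j + 2 => C (1 + a) * (X * powDiffPoly a (j + 1)) + X * powDiffPoly a j -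
      C a * (X * (X * powDiffPoly a j))

theorem powDiffPoly_add_two (a : R) (j : ℕ) :
    powDiffPoly a (j + 2) = C (1 + a) * (X * powDiffPoly a (j + 1)) + X * powDiffPoly a j -
      C a * (X * (X * powDiffPoly a j)) := by
  rw [powDiffPoly]

theorem sub_mul_eval_powDiffPoly {a u v x : R} (hadd : u + v = (1 + a) * x)
    (hmul : u * v = a * x ^ 2 - x) (j : ℕ) :
    (u - v) * (powDiffPoly a j).eval x = u ^ (j + 1) - v ^ (j + 1) := by
  induction j using Nat.twoStepInduction with
  | zero => simp [powDiffPoly]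
  | one =>
    simp only [powDiffPoly, eval_mul, eval_C, eval_X]
    rw [← hadd]
    ring
  | more j ih0 ih1 =>
    rw [powDiffPoly_add_two]
    simp only [eval_mul, eval_C, eval_X, eval_sub, eval_add]
    linear_combination (1 + a) * x * ih1 - (a * x ^ 2 - x) * ih0 -
      (u ^ (j + 2) - v ^ (j + 2)) * hadd + (u ^ (j + 1) - v ^ (j + 1)) * hmul

theorem map_powDiffPoly {A : Type*} [CommRing A] (f : R →+* A) (a : R) (j : ℕ) :
    (powDiffPoly a j).map f = powDiffPoly (f a) j := by
  induction j using Nat.twoStepInduction with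
  | zero => simp [powDiffPoly]
  | one => simp [powDiffPoly]
  | more j ih0 ih1 => simp [powDiffPoly_add_two, ih0, ih1]

/-- With G = 1/((1-t)(1-at)), the three-term recurrence of h_j is the relation G = 1 + (1+a)tG -
at^2 G multiplied by t^j G^(j-i), read off in one degree. Above the diagonal the truncated exponent
is 0 and both sides vanish. -/
theorem coeff_powDiffPoly_eq_coeff (a : R) (j i : ℕ) :
    (powDiffPoly a j).coeff i =
      PowerSeries.coeff (2 * i) (PowerSeries.X ^ j * twoGeomSeries a ^ (j + 1 - i)) := by
  have hconst : PowerSeries.constantCoeff (twoGeomSeries a) = 1 := by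
    simp [twoGeomSeries, geomSeries]
  have hc1 : PowerSeries.coeff 1 (twoGeomSeries a) = 1 + a := by
    rw [twoGeomSeries_eq, map_sub, map_add, PowerSeries.coeff_C_mul, PowerSeries.coeff_C_mul,
      ← zero_add 1, PowerSeries.coeff_succ_X_mul, PowerSeries.coeff_succ_X_mul]
    simp [hconst, PowerSeries.coeff_one]
  induction j using Nat.twoStepInduction generalizing i with
  | zero =>
    rcases i with _ | i
    · simp [powDiffPoly, hconst]
    · simp [powDiffPoly, coeff_one, PowerSeries.coeff_one]
  | one =>
    rcases i with _ | _ | i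
    · simp [powDiffPoly]
    · rw [powDiffPoly, coeff_C_mul, pow_one, show 2 * (0 + 1) = 1 + 1 by rfl,
        PowerSeries.coeff_succ_X_mul]
      simp [hc1]
    · rw [show 1 + 1 - (i + 1 + 1) = 0 by omega, powDiffPoly, coeff_C_mul, coeff_X,
        if_neg (by omega), pow_zero, mul_one, PowerSeries.coeff_X_pow, if_neg (by omega), mul_zero]
  | more j ih0 ih1 =>
    rw [powDiffPoly_add_two]
    rcases i with _ | _ | i
    · simp [PowerSeries.coeff_X_pow_mul']
    · have h1 : (X * (X * powDiffPoly a j)).coeff (0 + 1) = 0 := by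
        rw [coeff_X_mul, coeff_X_mul_zero]
      rw [coeff_sub, coeff_add, coeff_C_mul, coeff_C_mul, h1, coeff_X_mul, coeff_X_mul,
        ih0, ih1, PowerSeries.coeff_X_pow_mul', PowerSeries.coeff_X_pow_mul',
        PowerSeries.coeff_X_pow_mul']
      rcases j with _ | j
      · simp [hconst]
      · simp
    · have h1 : (X * (X * powDiffPoly a j)).coeff (i + 1 + 1) = (powDiffPoly a j).coeff i := by
        rw [coeff_X_mul, coeff_X_mul]
      rw [coeff_sub, coeff_add, coeff_C_mul, coeff_C_mul, h1, coeff_X_mul, coeff_X_mul,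
        ih0, ih0, ih1]
      rcases Nat.lt_or_ge j i with hij | hij
      · rw [show j + 1 + 1 - (i + 1) = 0 by omega, show j + 1 - (i + 1) = 0 by omega,
          show j + 1 - i = 0 by omega, show j + 2 + 1 - (i + 1 + 1) = 0 by omega]
        simp only [pow_zero, mul_one, PowerSeries.coeff_X_pow]
        rw [if_neg (by omega), if_neg (by omega), if_neg (by omega), if_neg (by omega)]
        ring
      · obtain ⟨s, rfl⟩ := Nat.exists_eq_add_of_le hij
        rw [show i + s + 1 + 1 - (i + 1) = s + 1 by omega, show i + s + 1 - (i + 1) = s by omega,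
          show i + s + 1 - i = s + 1 by omega, show i + s + 2 + 1 - (i + 1 + 1) = s + 1 by omega,
          show 2 * (i + 1 + 1) = 2 * i + 2 + 1 + 1 by ring, show 2 * (i + 1) = 2 * i + 1 + 1 by ring]
        have hG : PowerSeries.X ^ (i + s) * twoGeomSeries a ^ (s + 1) =
            PowerSeries.X ^ (i + s) * twoGeomSeries a ^ s + PowerSeries.C (1 + a) *
              (PowerSeries.X * (PowerSeries.X ^ (i + s) * twoGeomSeries a ^ (s + 1))) -
            PowerSeries.C a * (PowerSeries.X * (PowerSeries.X *
              (PowerSeries.X ^ (i + s) * twoGeomSeries a ^ (s + 1)))) := by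
          linear_combination
            PowerSeries.X ^ (i + s) * twoGeomSeries a ^ s * twoGeomSeries_eq a
        have hG' := congrArg (PowerSeries.coeff (2 * i + 1 + 1)) hG
        rw [map_sub, map_add, PowerSeries.coeff_C_mul, PowerSeries.coeff_C_mul,
          PowerSeries.coeff_succ_X_mul, PowerSeries.coeff_succ_X_mul,
          PowerSeries.coeff_succ_X_mul] at hG'
        rw [show PowerSeries.X ^ (i + s + 2) * twoGeomSeries a ^ (s + 1) = PowerSeries.X *
            (PowerSeries.X * (PowerSeries.X ^ (i + s) * twoGeomSeries a ^ (s + 1))) by ring,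
          PowerSeries.coeff_succ_X_mul, PowerSeries.coeff_succ_X_mul, hG',
          show PowerSeries.X ^ (i + s + 1) * twoGeomSeries a ^ (s + 1) = PowerSeries.X *
            (PowerSeries.X ^ (i + s) * twoGeomSeries a ^ (s + 1)) by ring,
          PowerSeries.coeff_succ_X_mul]
        ring

theorem coeff_powDiffPoly_eq_zero (a : R) {j i : ℕ} (h : j < i) :
    (powDiffPoly a j).coeff i = 0 := by
  rw [coeff_powDiffPoly_eq_coeff, show j + 1 - i = 0 by omega, pow_zero, mul_one,
    PowerSeries.coeff_X_pow, if_neg (by omega)]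

theorem coeff_powDiffPoly_self (a : R) (j : ℕ) :
    (1 - a) * (powDiffPoly a j).coeff j = 1 - a ^ (j + 1) := by
  induction j using Nat.twoStepInduction with
  | zero => simp [powDiffPoly]
  | one =>
    simp only [powDiffPoly, coeff_C_mul, coeff_X_one]
    ring
  | more j ih0 ih1 =>
    rw [powDiffPoly_add_two, coeff_sub, coeff_add, coeff_C_mul, coeff_C_mul, coeff_X_mul,
      coeff_X_mul, coeff_X_mul, coeff_X_mul, coeff_powDiffPoly_eq_zero a (Nat.lt_succ_self j)]
    linear_combination (1 + a) * ih1 - a * ih0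

theorem isTotallyNonneg_coeff_powDiffPoly (S : Subsemiring R) {a : R} (ha : a ∈ S)
    {n : ℕ} {r c : Fin n → ℕ} (hr : StrictMono r) (hc : StrictMono c) :
    (Matrix.of fun i j => (powDiffPoly a (r i)).coeff (c j)).det ∈ S := by
  obtain ⟨N, hN⟩ := (Set.finite_range r).bddAbove
  obtain ⟨M, hM, h0, h1⟩ := exists_isTotallyNonneg_coeff S ha (N + 1) (N + 1) 0 (zero_add _)
  -- The coefficients of h_j occupy the even columns, so their minors are minors of `M`.
  have h := hM n r (fun j => 2 * c j) hr (fun x y hxy => by have := hc hxy; dsimp only; omega)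
  convert h using 2
  ext i j
  have hi : r i < N + 1 := Nat.lt_succ_of_le (hN ⟨i, rfl⟩)
  rw [Matrix.of_apply, Matrix.submatrix_apply, coeff_powDiffPoly_eq_coeff]
  rcases Nat.eq_zero_or_pos (c j) with hj | hj
  · rw [hj, h0 _ hi _ le_rfl]
  · rw [h1 _ hi _ hj]

end PowDiffPoly

/-! ### Inverting a triangular system by Cramer's rule. -/

section Inverse

variable {R : Type*} [CommRing R]

/-- The determinant of the coefficients of `x ^ k, …, x ^ (k + n - 1)` in
`H (k + 1), …, H (k + n)`. -/
noncomputable def minorDet (H : ℕ → R[X]) (k n : ℕ) : R :=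
  (Matrix.of fun a b : Fin n => (H (k + 1 + a)).coeff (k + b)).det

/-- By triangularity, the windows of the two matrices on indices `k, …, k + n` are still inverse to
each other, so the adjugate gives the entries of `c` without division. -/
theorem mul_prod_coeff_eq_minorDet {H : ℕ → R[X]} (hH : ∀ j, ∀ i > j, (H j).coeff i = 0)
    {c : ℕ → ℕ → R} (hc : ∀ m, ∀ l > m, c m l = 0)
    (hcH : ∀ m, ∑ l ∈ Finset.range (m + 1), C (c m l) * H l = X ^ m) (k n : ℕ) :
    c (k + n) k * ∏ l ∈ Finset.range (n + 1), (H (k + l)).coeff (k + l) =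
      (-1) ^ n * minorDet H k n := by
  let B : Matrix (Fin (n + 1)) (Fin (n + 1)) R :=
    Matrix.of fun a b => (H (k + a)).coeff (k + b)
  let D : Matrix (Fin (n + 1)) (Fin (n + 1)) R := Matrix.of fun a b => c (k + a) (k + b)
  have hDB : D * B = 1 := by
    ext a b
    have h1 : (D * B) a b =
        ∑ l ∈ Finset.range (n + 1), c (k + a) (k + l) * (H (k + l)).coeff (k + b) := by
      rw [Matrix.mul_apply, Finset.sum_range]
      rfl
    have h2 : ∑ l ∈ Finset.range (k + (n + 1)), c (k + a) l * (H l).coeff (k + b) =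
        ∑ l ∈ Finset.range (n + 1), c (k + a) (k + l) * (H (k + l)).coeff (k + b) := by
      rw [Finset.sum_range_add, Finset.sum_eq_zero, zero_add]
      intro l hl
      rw [hH l _ (by have := Finset.mem_range.1 hl; omega), mul_zero]
    have h3 : ∑ l ∈ Finset.range (k + a + 1), c (k + a) l * (H l).coeff (k + b) =
        ∑ l ∈ Finset.range (k + (n + 1)), c (k + a) l * (H l).coeff (k + b) := by
      refine Finset.sum_subset (Finset.range_subset_range.2 (by omega)) ?_
      intro l _ hl
      rw [hc _ l (by rw [Finset.mem_range] at hl; omega), zero_mul]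
    have h4 := congrArg (fun p => p.coeff (k + (b : ℕ))) (hcH (k + a))
    simp only [finsetSum_coeff, coeff_C_mul, coeff_X_pow] at h4
    rw [h1, ← h2, ← h3, h4, Matrix.one_apply]
    simp only [add_right_inj, Fin.ext_iff, eq_comm]
  have hdet : B.det = ∏ l ∈ Finset.range (n + 1), (H (k + l)).coeff (k + l) := by
    rw [Matrix.det_of_isLowerTriangular B, Finset.prod_range]
    · rfl
    · intro a b hab
      exact hH _ _ (by have : a < b := hab; simp only [Fin.lt_def] at this; omega)
  have hadj : B.det • D = B.adjugate := by
    calc B.det • D = D * (B * B.adjugate) := by simp [Matrix.mul_adjugate]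
      _ = B.adjugate := by rw [← Matrix.mul_assoc, hDB, Matrix.one_mul]
  -- For this corner entry the cofactor omits the first row and the last column, leaving exactly
  -- `minorDet`.
  have h := congrFun (congrFun hadj (Fin.last n)) 0
  rw [Matrix.adjugate_fin_succ_eq_det_submatrix, Matrix.smul_apply, hdet, smul_eq_mul] at h
  rw [mul_comm]
  refine Eq.trans ?_ (h.trans ?_)
  · simp [D]
  · rw [minorDet]
    congr 2
    · simp
    · ext a b
      simp [B, add_assoc, add_comm 1]

theorem exists_sum_C_mul_eq_X_pow {K : Type*} [Field K] {H : ℕ → K[X]}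
    (hH : ∀ j, ∀ i > j, (H j).coeff i = 0) (hd : ∀ j, (H j).coeff j ≠ 0) (m : ℕ) :
    ∃ c : ℕ → K, (∀ l > m, c l = 0) ∧ ∑ l ∈ Finset.range (m + 1), C (c l) * H l = X ^ m := by
  induction m using Nat.strong_induction_on with
  | _ m ih =>
    choose! c hc0 hc using ih
    refine ⟨fun l => ((if l = m then 1 else 0) -
      ∑ i ∈ Finset.range m, (H m).coeff i * c i l) / (H m).coeff m, ?_, ?_⟩
    · intro l hl
      dsimp only
      rw [if_neg (by omega), Finset.sum_eq_zero, sub_zero, zero_div]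
      intro i hi
      have := Finset.mem_range.1 hi
      rw [hc0 i this l (by omega), mul_zero]
    · have hcm : ∀ i < m, ∑ l ∈ Finset.range (m + 1), C (c i l) * H l = X ^ i := by
        intro i hi
        rw [← hc i hi]
        symm
        refine Finset.sum_subset (Finset.range_subset_range.2 (by omega)) ?_
        intro l _ hl
        rw [hc0 i hi l (by rw [Finset.mem_range] at hl; omega), C_0, zero_mul]
      have hHm : H m = ∑ i ∈ Finset.range (m + 1), C ((H m).coeff i) * X ^ i := by
        simp_rw [C_mul_X_pow_eq_monomial]
        refine as_sum_range' _ _ ?_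
        rw [Nat.lt_succ_iff, natDegree_le_iff_coeff_eq_zero]
        exact hH m
      have key : C ((H m).coeff m) * ∑ l ∈ Finset.range (m + 1), C (((if l = m then 1 else 0) -
          ∑ i ∈ Finset.range m, (H m).coeff i * c i l) / (H m).coeff m) * H l =
          C ((H m).coeff m) * X ^ m := by
        calc _ = ∑ l ∈ Finset.range (m + 1), C ((if l = m then 1 else 0) -
            ∑ i ∈ Finset.range m, (H m).coeff i * c i l) * H l := by
              rw [Finset.mul_sum]
              refine Finset.sum_congr rfl fun l _ => ?_
              rw [← mul_assoc, ← C_mul, mul_div_cancel₀ _ (hd m)]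
          _ = H m - ∑ i ∈ Finset.range m, C ((H m).coeff i) *
                ∑ l ∈ Finset.range (m + 1), C (c i l) * H l := by
              simp only [C_sub, sub_mul, Finset.sum_sub_distrib, map_sum, C_mul, Finset.sum_mul,
                Finset.mul_sum]
              congr 1
              · rw [Finset.sum_eq_single m]
                · simp
                · intro l _ hl
                  simp [hl]
                · simp
              · rw [Finset.sum_comm]
                simp only [mul_assoc]
          _ = _ := by
              rw [Finset.sum_congr rfl fun i hi => by rw [hcm i (Finset.mem_range.1 hi)]]
              nth_rewrite 1 [hHm]
              rw [Finset.sum_range_succ]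
              ring
      exact mul_left_cancel₀ (C_ne_zero.2 (hd m)) key

end Inverse

/-! ### Nonnegativity and symmetry of the minors. -/

section Minors

theorem map_minorDet {R A : Type*} [CommRing R] [CommRing A] (f : R →+* A) (a : R) (k n : ℕ) :
    f (minorDet (powDiffPoly a) k n) = minorDet (powDiffPoly (f a)) k n := by
  rw [minorDet, RingHom.map_det, minorDet]
  congr 1
  ext i j
  simp [← map_powDiffPoly f]

/-- The integer polynomials with nonnegative coefficients. -/
def nonnegCoeffs : Subsemiring ℤ[X] where
  carrier := {p | ∀ i, 0 ≤ p.coeff i}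
  mul_mem' {p r} hp hr i := by
    rw [coeff_mul]
    exact Finset.sum_nonneg fun x _ => mul_nonneg (hp _) (hr _)
  one_mem' i := by
    rw [coeff_one]
    split_ifs <;> simp
  add_mem' {p r} hp hr i := by
    rw [coeff_add]
    exact add_nonneg (hp i) (hr i)
  zero_mem' i := by simp

theorem coeff_minorDet_nonneg (k n i : ℕ) :
    0 ≤ (minorDet (powDiffPoly (X : ℤ[X])) k n).coeff i := by
  have hX : (X : ℤ[X]) ∈ nonnegCoeffs := by
    intro i
    rw [coeff_X]
    split_ifs <;> simp
  have h : minorDet (powDiffPoly (X : ℤ[X])) k n ∈ nonnegCoeffs :=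
    isTotallyNonneg_coeff_powDiffPoly nonnegCoeffs hX
      (r := fun a : Fin n => k + 1 + a) (c := fun b : Fin n => k + b)
      (fun a b hab => by simpa using hab) (fun a b hab => by simpa using hab)
  exact h i

theorem invert_toLaurent_coeff_powDiffPoly (j i : ℕ) :
    LaurentPolynomial.invert (toLaurent ((powDiffPoly (X : ℤ[X]) j).coeff i)) =
      LaurentPolynomial.T (j - 2 * i) * toLaurent ((powDiffPoly (X : ℤ[X]) j).coeff i) := by
  induction j using Nat.twoStepInduction generalizing i with
  | zero =>
    rcases i with _ | i
    · simp [powDiffPoly]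
    · simp [powDiffPoly, coeff_one]
  | one =>
    rcases i with _ | _ | i
    · simp [powDiffPoly]
    · rw [powDiffPoly, coeff_C_mul, coeff_X_one, mul_one, map_add, map_one, toLaurent_X, map_add,
        map_one, LaurentPolynomial.invert_T, mul_add, mul_one, ← LaurentPolynomial.T_add, add_comm]
      congr 1
    · rw [powDiffPoly, coeff_C_mul, coeff_X, if_neg (by omega)]
      simp
  | more j ih0 ih1 =>
    rw [powDiffPoly_add_two]
    rcases i with _ | _ | i
    · simp
    · have h1 : (X * (X * powDiffPoly (X : ℤ[X]) j)).coeff (0 + 1) = 0 := by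
        rw [coeff_X_mul, coeff_X_mul_zero]
      rw [coeff_sub, coeff_add, coeff_C_mul, coeff_C_mul, h1, coeff_X_mul, coeff_X_mul]
      rcases j with _ | _ | j
      · simp [powDiffPoly]
      · simp [powDiffPoly]
      · simp [powDiffPoly_add_two]
    · have h1 : (X * (X * powDiffPoly (X : ℤ[X]) j)).coeff (i + 1 + 1) =
          (powDiffPoly X j).coeff i := by
        rw [coeff_X_mul, coeff_X_mul]
      rw [coeff_sub, coeff_add, coeff_C_mul, coeff_C_mul, h1, coeff_X_mul, coeff_X_mul]
      simp only [map_sub, map_add, map_mul, map_one, ih0, ih1, toLaurent_X,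
        LaurentPolynomial.invert_T]
      have e1 : LaurentPolynomial.T ((j + 1 : ℕ) - 2 * (i + 1 : ℕ) : ℤ) =
          (LaurentPolynomial.T (j - 2 * i - 1) : LaurentPolynomial ℤ) := by
        congr 1; push_cast; ring
      have e2 : LaurentPolynomial.T ((j : ℤ) - 2 * (i + 1 : ℕ)) =
          (LaurentPolynomial.T (j - 2 * i - 1) * LaurentPolynomial.T (-1) :
            LaurentPolynomial ℤ) := by
        rw [← LaurentPolynomial.T_add]
        congr 1; push_cast; ring
      have e3 : LaurentPolynomial.T ((j : ℤ) - 2 * i) =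
          (LaurentPolynomial.T (j - 2 * i - 1) * LaurentPolynomial.T 1 :
            LaurentPolynomial ℤ) := by
        rw [← LaurentPolynomial.T_add]
        congr 1; ring
      have e4 : LaurentPolynomial.T ((j + 2 : ℕ) - 2 * (i + 1 + 1 : ℕ) : ℤ) =
          (LaurentPolynomial.T (j - 2 * i - 1) * LaurentPolynomial.T (-1) :
            LaurentPolynomial ℤ) := by
        rw [← LaurentPolynomial.T_add]
        congr 1; push_cast; ring
      have e5 : LaurentPolynomial.T (-1) * LaurentPolynomial.T 1 = (1 : LaurentPolynomial ℤ) := by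
        rw [← LaurentPolynomial.T_add]
        simp
      rw [e1, e2, e3, e4]
      linear_combination -(toLaurent ((powDiffPoly X (j + 1)).coeff (i + 1)) *
        LaurentPolynomial.T (j - 2 * i - 1 : ℤ)) * e5

/-- The exponent j - 2i splits into a row part and a column part, so the powers of q factor out of
the determinant. -/
theorem exists_invert_toLaurent_minorDet (k n : ℕ) :
    ∃ d : ℤ, LaurentPolynomial.invert (toLaurent (minorDet (powDiffPoly (X : ℤ[X])) k n)) =
      LaurentPolynomial.T d * toLaurent (minorDet (powDiffPoly (X : ℤ[X])) k n) := by
  have hprod (f : Fin n → ℤ) :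
      ∃ d : ℤ, ∏ a, (LaurentPolynomial.T (f a) : LaurentPolynomial ℤ) = LaurentPolynomial.T d := by
    refine Finset.prod_induction _ (fun x => ∃ d : ℤ, x = LaurentPolynomial.T d) ?_ ⟨0, by simp⟩
      fun a _ => ⟨_, rfl⟩
    rintro _ _ ⟨d, rfl⟩ ⟨e, rfl⟩
    exact ⟨d + e, (LaurentPolynomial.T_add d e).symm⟩
  obtain ⟨d, hd⟩ := hprod fun a => ((k + 1 + a : ℕ) : ℤ)
  obtain ⟨e, he⟩ := hprod fun b => -2 * ((k + b : ℕ) : ℤ)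
  refine ⟨d + e, ?_⟩
  rw [LaurentPolynomial.T_add, ← hd, ← he, mul_assoc, minorDet, RingHom.map_det,
    ← Matrix.det_mul_row, ← Matrix.det_mul_column]
  erw [AlgEquiv.map_det]
  congr 1
  ext1 a b
  simp only [RingHom.mapMatrix_apply, AlgEquiv.mapMatrix_apply, Matrix.map_apply, Matrix.of_apply]
  erw [invert_toLaurent_coeff_powDiffPoly]
  rw [← mul_assoc, ← LaurentPolynomial.T_add, neg_mul, sub_eq_add_neg]

/-- The reversal of `p` is `p` shifted by a power of the variable. Both have nonzero constant term,
so the shift is trivial. -/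
theorem coeff_eq_coeff_natDegree_sub {p : ℤ[X]} {d : ℤ}
    (hp : LaurentPolynomial.invert (toLaurent p) = LaurentPolynomial.T d * toLaurent p)
    (h0 : p.coeff 0 ≠ 0) {i : ℕ} (hi : i ≤ p.natDegree) :
    p.coeff i = p.coeff (p.natDegree - i) := by
  have hrev : toLaurent p.reverse = LaurentPolynomial.T (d + p.natDegree) * toLaurent p := by
    rw [LaurentPolynomial.toLaurent_reverse, hp, LaurentPolynomial.T_add, mul_right_comm]
  have hr0 : p.reverse.coeff 0 ≠ 0 := by
    rw [coeff_zero_reverse, leadingCoeff_ne_zero]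
    rintro rfl
    simp at h0
  have key : p.reverse = p := by
    obtain ⟨e, he | he⟩ := Int.eq_nat_or_neg (d + p.natDegree)
    · rw [he, ← toLaurent_X_pow, ← map_mul, toLaurent_inj] at hrev
      rcases e with _ | e
      · simpa using hrev
      · rw [hrev, pow_succ', mul_assoc, coeff_X_mul_zero] at hr0
        exact absurd rfl hr0
    · have hrev' : LaurentPolynomial.T (e : ℤ) * toLaurent p.reverse = toLaurent p := by
        rw [hrev, he, ← mul_assoc, ← LaurentPolynomial.T_add, add_neg_cancel,
          LaurentPolynomial.T_zero, one_mul]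
      rw [← toLaurent_X_pow, ← map_mul, toLaurent_inj] at hrev'
      rcases e with _ | e
      · simpa using hrev'
      · rw [← hrev', pow_succ', mul_assoc, coeff_X_mul_zero] at h0
        exact absurd rfl h0
  conv_lhs => rw [← key]
  rw [coeff_reverse, revAt_le hi]

/-- The ballot numbers, the absolute values of the coefficients expressing `x ^ m` through the
polynomials `powDiffPoly 0`. -/
def ballot : ℕ → ℕ → ℤ
  | 0, 0 => 1
  | 0, _ + 1 => 0
  | _ + 1, 0 => 0
  | m + 1, l + 1 => ∑ j ∈ Finset.Icc l m, ballot m j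

theorem ballot_nonneg (m l : ℕ) : 0 ≤ ballot m l := by
  induction m generalizing l with
  | zero => cases l <;> simp [ballot]
  | succ m ih =>
    cases l with
    | zero => simp [ballot]
    | succ l =>
      rw [ballot]
      exact Finset.sum_nonneg fun j _ => ih j

theorem ballot_eq_zero {m l : ℕ} (h : m < l) : ballot m l = 0 := by
  obtain ⟨l, rfl⟩ : ∃ l', l = l' + 1 := ⟨l - 1, by omega⟩
  cases m with
  | zero => rfl
  | succ m => rw [ballot, Finset.Icc_eq_empty (by omega), Finset.sum_empty]

theorem ballot_self (m : ℕ) : ballot m m = 1 := by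
  induction m with
  | zero => rfl
  | succ m ih => rw [ballot, Finset.Icc_self, Finset.sum_singleton, ih]

theorem ballot_pos {m l : ℕ} (h : l ≤ m) : 0 < ballot (m + 1) (l + 1) := by
  rw [ballot]
  calc 0 < ballot m m := by rw [ballot_self]; exact one_pos
    _ ≤ _ := Finset.single_le_sum (fun j _ => ballot_nonneg m j) (Finset.mem_Icc.2 ⟨h, le_rfl⟩)

/-- At a = 0 the recurrence reads x h_(j+1) = h_(j+2) - x h_j; iterating it gives the alternating
sum that underlies the recursion of `ballot`. -/
theorem X_mul_powDiffPoly_zero (j : ℕ) :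
    X * powDiffPoly (0 : ℤ) j =
      ∑ l ∈ Finset.range (j + 1), (-1) ^ (j + l) * powDiffPoly (0 : ℤ) (l + 1) := by
  induction j with
  | zero => simp [powDiffPoly]
  | succ j ih =>
    rw [Finset.sum_range_succ]
    have h : ∑ l ∈ Finset.range (j + 1), (-1) ^ (j + 1 + l) * powDiffPoly (0 : ℤ) (l + 1) =
        -(X * powDiffPoly (0 : ℤ) j) := by
      rw [ih, ← Finset.sum_neg_distrib]
      refine Finset.sum_congr rfl fun l _ => ?_
      ring
    rw [h, powDiffPoly_add_two, (Even.neg_one_pow (by simp) : (-1 : ℤ[X]) ^ (j + 1 + (j + 1)) = 1)]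
    simp

theorem sum_ballot_mul_powDiffPoly (m : ℕ) :
    ∑ l ∈ Finset.range (m + 1), C ((-1) ^ (m + l) * ballot m l) * powDiffPoly (0 : ℤ) l =
      X ^ m := by
  induction m with
  | zero => simp [ballot, powDiffPoly]
  | succ m ih =>
    rw [pow_succ', ← ih, Finset.mul_sum, Finset.sum_range_succ']
    have h (j : ℕ) : X * (C ((-1) ^ (m + j) * ballot m j) * powDiffPoly (0 : ℤ) j) =
        ∑ l ∈ Finset.range (j + 1),
          C ((-1) ^ (m + l) * ballot m j) * powDiffPoly (0 : ℤ) (l + 1) := by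
      rw [mul_left_comm, X_mul_powDiffPoly_zero, Finset.mul_sum]
      refine Finset.sum_congr rfl fun l _ => ?_
      simp only [map_mul, map_pow, map_neg, map_one]
      have : (-1 : ℤ[X]) ^ (j + j) = 1 := Even.neg_one_pow (by simp)
      linear_combination (-1) ^ m * (-1) ^ l * C (ballot m j) * powDiffPoly 0 (l + 1) * this
    simp_rw [h]
    rw [Finset.sum_comm' (t' := Finset.range (m + 1)) (s' := fun l => Finset.Icc l m)
      (by intro x y; simp only [Finset.mem_range, Finset.mem_Icc]; omega)]
    simp only [ballot, mul_zero, C_0, zero_mul, add_zero]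
    refine Finset.sum_congr rfl fun l _ => ?_
    rw [← Finset.sum_mul, Finset.mul_sum, map_sum]
    congr 1
    refine Finset.sum_congr rfl fun j _ => ?_
    congr 2
    ring

/-- At a = 0 the diagonal entries are 1, so Cramer's rule equates the minor with the explicit
inverse entry up to sign. -/
theorem minorDet_powDiffPoly_zero (k n : ℕ) :
    minorDet (powDiffPoly (0 : ℤ)) k n = ballot (k + n) k := by
  have h := mul_prod_coeff_eq_minorDet (H := powDiffPoly (0 : ℤ))
    (fun j i hij => coeff_powDiffPoly_eq_zero 0 hij)
    (c := fun m l => (-1) ^ (m + l) * ballot m l)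
    (fun m l hl => by rw [ballot_eq_zero hl, mul_zero])
    sum_ballot_mul_powDiffPoly k n
  have hd (j : ℕ) : (powDiffPoly (0 : ℤ) j).coeff j = 1 := by
    simpa using coeff_powDiffPoly_self (0 : ℤ) j
  simp only [hd, Finset.prod_const_one, mul_one] at h
  have hs : (-1 : ℤ) ^ (k + n + k) = (-1) ^ n := by
    rw [show k + n + k = k + k + n by ring, pow_add, Even.neg_one_pow (by simp), one_mul]
  rw [hs] at h
  exact (mul_left_cancel₀ (pow_ne_zero _ (by norm_num)) h).symm

theorem minorDet_powDiffPoly_zero_succ {R : Type*} [CommRing R] (a : R) (n : ℕ) :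
    minorDet (powDiffPoly a) 0 (n + 1) = 0 := by
  refine Matrix.det_eq_zero_of_column_eq_zero 0 fun i => ?_
  rw [Matrix.of_apply, coeff_powDiffPoly_eq_coeff, PowerSeries.coeff_X_pow_mul',
    if_neg (by simp)]

theorem coeff_minorDet_symm (k n : ℕ) {i : ℕ}
    (hi : i ≤ (minorDet (powDiffPoly (X : ℤ[X])) k n).natDegree) :
    (minorDet (powDiffPoly (X : ℤ[X])) k n).coeff i =
      (minorDet (powDiffPoly (X : ℤ[X])) k n).coeff
        ((minorDet (powDiffPoly (X : ℤ[X])) k n).natDegree - i) := by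
  -- In this case the minor is zero, since h_j has no constant term for j ≥ 1; otherwise the value
  -- at q = 0 is a positive ballot number.
  by_cases h : k = 0 ∧ n ≠ 0
  · obtain ⟨rfl, hn⟩ := h
    obtain ⟨n, rfl⟩ := Nat.exists_eq_succ_of_ne_zero hn
    simp [minorDet_powDiffPoly_zero_succ]
  · obtain ⟨d, hd⟩ := exists_invert_toLaurent_minorDet k n
    refine coeff_eq_coeff_natDegree_sub hd ?_ hi
    have h0 : constantCoeff (minorDet (powDiffPoly (X : ℤ[X])) k n) = ballot (k + n) k := by
      rw [map_minorDet, constantCoeff_apply, coeff_X_zero, minorDet_powDiffPoly_zero]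
    rw [← constantCoeff_apply, h0]
    rcases k with _ | k
    · obtain rfl : n = 0 := by
        by_contra hn
        exact h ⟨rfl, hn⟩
      simp [ballot]
    · rw [add_right_comm]
      exact (ballot_pos (Nat.le_add_right k n)).ne'

end Minors

/-! ### Telescoping, uniqueness and the Faulhaber family. -/

section Faulhaber

theorem q_pow_injective : Function.Injective fun n : ℕ => q ^ n := by
  intro a b hab
  have h : (X : ℚ[X]) ^ a = X ^ b := by
    apply RatFunc.algebraMap_injective ℚ
    simpa [q] using hab
  simpa using congrArg natDegree h

theorem q_ne_zero : q ≠ 0 := RatFunc.X_ne_zero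

theorem q_pow_ne_one {n : ℕ} (hn : n ≠ 0) : q ^ n ≠ 1 := by
  intro h
  exact hn (q_pow_injective (h.trans (pow_zero q).symm))

theorem one_sub_q_ne_zero : 1 - q ≠ 0 :=
  sub_ne_zero.2 fun h => q_pow_ne_one one_ne_zero (by rw [pow_one, ← h])

theorem qNum_ne_zero {k : ℕ} (hk : k ≠ 0) : qNum k ≠ 0 :=
  div_ne_zero (sub_ne_zero.2 (q_pow_ne_one hk).symm) one_sub_q_ne_zero

theorem qFact_add (k n : ℕ) :
    qFact (k + n) = qFact k * ∏ l ∈ Finset.range n, qNum (k + l + 1) := by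
  induction n with
  | zero => simp
  | succ n ih =>
    rw [Finset.prod_range_succ, ← mul_assoc, ← ih, ← add_assoc, qFact,
      Finset.prod_Icc_succ_top (by omega)]
    rfl

theorem qFact_ne_zero (k : ℕ) : qFact k ≠ 0 :=
  Finset.prod_ne_zero_iff.2 fun i hi =>
    qNum_ne_zero (by have := Finset.mem_Icc.1 hi; omega)

theorem toRatFunc_injective : Function.Injective toRatFunc := by
  intro p r h
  have h1 (p : ℤ[X]) :
      toRatFunc p = algebraMap ℚ[X] (RatFunc ℚ) (p.map (Int.castRingHom ℚ)) := by
    induction p using Polynomial.induction_on' with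
    | add p r hp hr => simp only [toRatFunc, map_add, Polynomial.map_add] at *; rw [hp, hr]
    | monomial n a => simp [toRatFunc, q, ← C_mul_X_pow_eq_monomial]
  rw [h1, h1] at h
  exact map_injective _ Int.cast_injective (RatFunc.algebraMap_injective ℚ h)

/-- The normalized variable `[n] [n + 1] / q ^ n` of the Faulhaber expansion. -/
noncomputable def faulhaberVar (n : ℕ) : RatFunc ℚ := qNum n * qNum (n + 1) / q ^ n

theorem faulhaberVar_injective : Function.Injective faulhaberVar := by
  intro a b h
  have hq (n : ℕ) : q ^ n ≠ 0 := pow_ne_zero n q_ne_zero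
  have h1 := one_sub_q_ne_zero
  have hp : (1 - q ^ a) * (1 - q ^ (a + 1)) * q ^ b = (1 - q ^ b) * (1 - q ^ (b + 1)) * q ^ a := by
    simp only [faulhaberVar, qNum] at h
    have ha := hq a
    have hb := hq b
    field_simp at h
    linear_combination h
  -- Up to a factor, y_n is q^(-n) + q^(n+1) plus a constant, whose only symmetry is n ↦ -n-1.
  have h2 : (q ^ a - q ^ b) * (q ^ (a + b + 1) - 1) = 0 := by
    linear_combination hp
  rcases mul_eq_zero.1 h2 with h | h
  · exact q_pow_injective (sub_eq_zero.1 h)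
  · exact absurd (sub_eq_zero.1 h) (q_pow_ne_one (Nat.succ_ne_zero _))

theorem pow_mul_faulhaberVar_pow {m k : ℕ} (hk : k ≤ m) (n : ℕ) :
    q ^ ((m + 1) * n) * faulhaberVar n ^ (k + 1) =
      q ^ ((m - k) * n) * (qNum n * qNum (n + 1)) ^ (k + 1) := by
  obtain ⟨d, rfl⟩ := Nat.exists_eq_add_of_le hk
  have := pow_ne_zero ((k + 1) * n) q_ne_zero
  rw [faulhaberVar, div_pow, ← pow_mul, mul_comm n, Nat.add_sub_cancel_left,
    show (k + d + 1) * n = d * n + (k + 1) * n by ring, pow_add]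
  field_simp

theorem faulhaberVar_sub (n : ℕ) :
    faulhaberVar (n + 1) - faulhaberVar n = qNum (2 * (n + 1)) / q ^ (n + 1) := by
  have h1 := one_sub_q_ne_zero
  have h2 := q_ne_zero
  have h3 := pow_ne_zero n q_ne_zero
  simp only [faulhaberVar, qNum, mul_add, pow_add, mul_comm 2 n, pow_mul]
  field_simp
  ring

theorem faulhaberVar_add (n : ℕ) :
    faulhaberVar (n + 1) + faulhaberVar n = (1 + q) * (qNum (n + 1) ^ 2 / q ^ (n + 1)) := by
  have h1 := one_sub_q_ne_zero
  have h2 := q_ne_zero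
  have h3 := pow_ne_zero n q_ne_zero
  simp only [faulhaberVar, qNum, pow_add]
  field_simp
  ring

theorem faulhaberVar_mul (n : ℕ) :
    faulhaberVar (n + 1) * faulhaberVar n =
      q * (qNum (n + 1) ^ 2 / q ^ (n + 1)) ^ 2 - qNum (n + 1) ^ 2 / q ^ (n + 1) := by
  have h1 := one_sub_q_ne_zero
  have h2 := q_ne_zero
  have h3 := pow_ne_zero n q_ne_zero
  simp only [faulhaberVar, qNum, pow_add]
  field_simp
  ring

theorem oddPowerSum_succ (m n : ℕ) :
    oddPowerSum m (n + 1) = q ^ (m + 1) * oddPowerSum m n +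
      qNum (2 * (n + 1)) / qNum 2 * qNum (n + 1) ^ (2 * m) := by
  rw [oddPowerSum, Finset.sum_Icc_succ_top (by omega), oddPowerSum, Finset.mul_sum, Nat.sub_self,
    mul_zero, pow_zero, mul_one]
  congr 1
  refine Finset.sum_congr rfl fun k hk => ?_
  have := (Finset.mem_Icc.1 hk).2
  rw [show n + 1 - k = n - k + 1 by omega, mul_add, mul_one, pow_add]
  ring

theorem oddPowerSum_eq {m : ℕ} {c : ℕ → RatFunc ℚ}
    (hc : ∑ l ∈ Finset.range (m + 1), C (c l) * powDiffPoly q l = X ^ m) (n : ℕ) :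
    oddPowerSum m n = q ^ ((m + 1) * n) *
      ∑ l ∈ Finset.range (m + 1), c l * (faulhaberVar n ^ (l + 1) / qNum 2) := by
  induction n with
  | zero => simp [oddPowerSum, faulhaberVar, qNum]
  | succ n ih =>
    have hx := congrArg (eval (qNum (n + 1) ^ 2 / q ^ (n + 1))) hc
    simp only [eval_finsetSum, eval_mul, eval_C, eval_pow, eval_X] at hx
    have hdiff : ∑ l ∈ Finset.range (m + 1), c l * (faulhaberVar (n + 1) ^ (l + 1) / qNum 2) -
        ∑ l ∈ Finset.range (m + 1), c l * (faulhaberVar n ^ (l + 1) / qNum 2) =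
        (faulhaberVar (n + 1) - faulhaberVar n) / qNum 2 *
          (qNum (n + 1) ^ 2 / q ^ (n + 1)) ^ m := by
      rw [← hx, ← Finset.sum_sub_distrib, Finset.mul_sum]
      refine Finset.sum_congr rfl fun l _ => ?_
      rw [← mul_sub, ← sub_div, ← sub_mul_eval_powDiffPoly (faulhaberVar_add n)
        (faulhaberVar_mul n)]
      ring
    rw [oddPowerSum_succ, ih, eq_add_of_sub_eq hdiff, faulhaberVar_sub, div_pow, mul_add,
      ← mul_assoc, ← pow_add, show m + 1 + (m + 1) * n = (m + 1) * (n + 1) by ring, add_comm]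
    have h2 := pow_ne_zero ((m + 1) * (n + 1)) q_ne_zero
    rw [← pow_mul, ← pow_mul, mul_comm (n + 1) m, div_right_comm, div_mul_div_comm, ← pow_add,
      show n + 1 + m * (n + 1) = (m + 1) * (n + 1) by ring]
    field_simp

theorem coeff_powDiffPoly_q_self (j : ℕ) : (powDiffPoly q j).coeff j = qNum (j + 1) := by
  rw [qNum, eq_div_iff one_sub_q_ne_zero, mul_comm, coeff_powDiffPoly_self]

/-- After division by q^((m+1)n) both expansions are polynomials in y_n with coefficients
independent of n. They agree at infinitely many points, hence coefficientwise. -/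
theorem IsFaulhaberFamily.unique {m : ℕ} {P P' : Fin (m + 1) → ℤ[X]} (hP : IsFaulhaberFamily m P)
    (hP' : IsFaulhaberFamily m P') : P = P' := by
  let a (Q : Fin (m + 1) → ℤ[X]) (k : Fin (m + 1)) : RatFunc ℚ :=
    (-1) ^ (m - (k : ℕ)) * (qFact k / qFact (m + 1)) * toRatFunc (Q k.rev) / qNum 2
  have h2 : qNum 2 ≠ 0 := qNum_ne_zero two_ne_zero
  have hsum (Q : Fin (m + 1) → ℤ[X]) (hQ : IsFaulhaberFamily m Q) (n : ℕ) :
      oddPowerSum m n = q ^ ((m + 1) * n) * ∑ k, a Q k * faulhaberVar n ^ ((k : ℕ) + 1) := by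
    rw [hQ n, Finset.mul_sum]
    refine Finset.sum_congr rfl fun k _ => ?_
    have := pow_mul_faulhaberVar_pow (Nat.le_of_lt_succ k.2) n
    simp only [a]
    linear_combination -((-1) ^ (m - (k : ℕ)) * (qFact k / qFact (m + 1)) * toRatFunc (Q k.rev) /
      qNum 2) * this
  let D : (RatFunc ℚ)[X] := ∑ k : Fin (m + 1), C (a P k - a P' k) * X ^ ((k : ℕ) + 1)
  have hD : D = 0 := by
    refine eq_zero_of_infinite_isRoot D ((Set.infinite_range_of_injective
      faulhaberVar_injective).mono ?_)
    rintro _ ⟨n, rfl⟩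
    have h := (hsum P hP n).symm.trans (hsum P' hP' n)
    have h' := mul_left_cancel₀ (pow_ne_zero _ q_ne_zero) h
    simp only [Set.mem_ofPred_eq, IsRoot.def, D, eval_finsetSum, eval_mul, eval_C, eval_pow, eval_X,
      sub_mul, Finset.sum_sub_distrib, h', sub_self]
  have hcoeff (k : Fin (m + 1)) : a P k = a P' k := by
    have h := congrArg (fun p => p.coeff ((k : ℕ) + 1)) hD
    simp only [D, finsetSum_coeff, coeff_C_mul, coeff_X_pow, coeff_zero] at h
    rw [Finset.sum_eq_single k] at h
    · simpa [sub_eq_zero] using h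
    · intro l _ hl
      rw [if_neg, mul_zero]
      intro h'
      exact hl (Fin.ext (by omega))
    · simp
  funext k
  have h := hcoeff k.rev
  simp only [a, Fin.rev_rev] at h
  apply toRatFunc_injective
  have h3 : (-1 : RatFunc ℚ) ^ (m - (k.rev : ℕ)) * (qFact k.rev / qFact (m + 1)) ≠ 0 :=
    mul_ne_zero (pow_ne_zero _ (by simp)) (div_ne_zero (qFact_ne_zero _) (qFact_ne_zero _))
  exact mul_left_cancel₀ h3 ((div_left_inj' h2).1 h)

theorem toRatFunc_minorDet (k n : ℕ) :
    toRatFunc (minorDet (powDiffPoly X) k n) = minorDet (powDiffPoly q) k n := by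
  have h := map_minorDet (aeval q : ℤ[X] →ₐ[ℤ] RatFunc ℚ).toRingHom X k n
  simpa [toRatFunc] using h

theorem isFaulhaberFamily_minorDet (m : ℕ) :
    IsFaulhaberFamily m fun k => minorDet (powDiffPoly (X : ℤ[X])) (m - (k : ℕ)) k := by
  have hH : ∀ j, ∀ i > j, (powDiffPoly q j).coeff i = 0 :=
    fun j i hij => coeff_powDiffPoly_eq_zero q hij
  choose c hc0 hc using exists_sum_C_mul_eq_X_pow hH fun j => by
    rw [coeff_powDiffPoly_q_self]
    exact qNum_ne_zero (Nat.succ_ne_zero j)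
  intro n
  rw [oddPowerSum_eq (hc m), Finset.sum_range, Finset.mul_sum]
  refine Finset.sum_congr rfl fun k _ => ?_
  have hk : (k : ℕ) ≤ m := Nat.le_of_lt_succ k.2
  have hrev : (k.rev : ℕ) = m - k := by rw [Fin.val_rev]; omega
  have hmk : m - (m - (k : ℕ)) = k := by omega
  have hpow := pow_mul_faulhaberVar_pow hk n
  have hdet := mul_prod_coeff_eq_minorDet hH hc0 hc k (m - k)
  have hfact := qFact_add k (m - k + 1)
  simp only [coeff_powDiffPoly_q_self] at hdet
  rw [show (k : ℕ) + (m - k + 1) = m + 1 by omega] at hfact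
  rw [show (k : ℕ) + (m - k) = m by omega] at hdet
  have hf := qFact_ne_zero (m + 1)
  have hcm : c m k = (-1) ^ (m - (k : ℕ)) * (qFact k / qFact (m + 1)) *
      minorDet (powDiffPoly q) k (m - k) := by
    field_simp
    rw [hfact]
    linear_combination qFact k * hdet
  simp only [hrev, hmk, toRatFunc_minorDet, ← hcm]
  linear_combination c m k / qNum 2 * hpow

end Faulhaber

end QFaulhaber

theorem mainTheorem4 (m : ℕ) :
    (∃! P : Fin (m + 1) → ℤ[X], QFaulhaber.IsFaulhaberFamily m P) ∧
    ∀ P : Fin (m + 1) → ℤ[X], QFaulhaber.IsFaulhaberFamily m P →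
      ∀ k : Fin (m + 1),
        (∀ i : ℕ, 0 ≤ (P k).coeff i) ∧
        (∀ i : ℕ, i ≤ (P k).natDegree →
          (P k).coeff i = (P k).coeff ((P k).natDegree - i)) := by
  have hfam := QFaulhaber.isFaulhaberFamily_minorDet m
  refine ⟨⟨_, hfam, fun P hP => hP.unique hfam⟩, fun P hP k => ?_⟩
  rw [hP.unique hfam]
  exact ⟨fun i => QFaulhaber.coeff_minorDet_nonneg _ _ i,
    fun i hi => QFaulhaber.coeff_minorDet_symm _ _ hi⟩
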